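/- Let $n\ge 0$, let $\Omega\subset\mathbb{R}^n$ be compact and non-empty, and let $p\ge 1$. Let $f:[0,+\infty]\to[0,+\infty]$ be convex and lower semicontinuous with $f(0)=0$ and $\lim_{t\to+\infty} f(t)/t=+\infty$. Let $g:[0,1]\to(-\infty,+\infty]$ be lower semicontinuous and subadditive ($g(s+t)\le g(s)+g(t)$ whenever $s,t\ge 0$ and $s+t\le 1$) with $g(0)=0$ and $\lim_{t\to 0^+} g(t)/t=+\infty$. For Borel probability measures $\mu,\nu$ on $\Omega$ set $$T_p(\mu,\nu)=\inf_\gamma\int_{\Omega\times\Omega}|x-y|^p\,\gamma(dx,dy),$$ where the infimum is over all probability measures $\gamma$ on $\Omega\times\Omega$ with marginals $\mu$ and $\nu$, $$F(\mu)=\begin{cases}\int_\Omega f(u(x))\,dx & \text{if } \mu=u\cdot\mathcal{L}^n \text{ with } u\in L^1(\Omega),\\ +\infty & \text{otherwise,}\end{cases}$$ $$G(\nu)=\begin{cases}\sum_{i} g(a_i) & \text{if } \nu=\sum_{i} a_i\delta_{x_i} \text{ (a countable sum, with the points } x_i \text{ distinct)},\\ +\infty & \text{if } \nu \text{ is not atomic.}\end{cases}$$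 Then the problem $$\min\{T_p(\mu,\nu)+F(\mu)+G(\nu) : \mu,\nu \text{ Borel probability measures on } \Omega\}$$ has at least one solution: there are probability measures $\mu,\nu$ on $\Omega$ such that $T_p(\mu,\nu)+F(\mu)+G(\nu)\le T_p(\mu',\nu')+F(\mu')+G(\nu')$ for all probability measures $\mu',\nu'$ on $\Omega$. -/

import Mathlib

open MeasureTheory Filter Topology Set
open scoped ENNReal NNReal

noncomputable section

namespace UrbanPlanning

/-- The transport cost `T_p(μ, ν) = inf_γ ∫ |x - y| ^ p dγ`, the infimum being taken over all
transport plans `γ`, i.e. all measures on the product with marginals `μ` and `ν`. -/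
def transportCost {X : Type*} [PseudoEMetricSpace X] [MeasurableSpace X] (p : ℝ)
    (μ ν : Measure X) : ℝ≥0∞ :=
  ⨅ (γ : Measure (X × X)) (_ : γ.map Prod.fst = μ ∧ γ.map Prod.snd = ν),
    ∫⁻ z, edist z.1 z.2 ^ p ∂γ

/-- The functional `F`: it is `∫ f(u) dm` if `μ` has a density `u` with respect to the reference
measure `m`, and `+∞` (the infimum of the empty family) otherwise. The density is unique
up to null sets, so that the infimum is over a single value. Since `μ` will be a probability
measure, the density is automatically integrable, with integral one. -/
def densityCost {X : Type*} [MeasurableSpace X] (m : Measure X) (f : ℝ≥0∞ → ℝ≥0∞)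
    (μ : Measure X) : ℝ≥0∞ :=
  ⨅ (u : X → ℝ≥0∞) (_ : Measurable u ∧ μ = m.withDensity u), ∫⁻ x, f (u x) ∂m

/-- `ν` is atomic: `ν = ∑ i, a i • δ_(x i)` for some sequences of masses and points. -/
def IsAtomic {X : Type*} [MeasurableSpace X] (ν : Measure X) : Prop :=
  ∃ (a : ℕ → ℝ≥0∞) (x : ℕ → X), ν = Measure.sum fun i => a i • Measure.dirac (x i)

/-- The sum of a family of extended real numbers: the sum of the positive parts minus the
sum of the negative parts. It is meaningful as soon as one of the two is finite. -/
def extSum {ι : Type*} (c : ι → EReal) : EReal :=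
  ((∑' i, (c i).toENNReal : ℝ≥0∞) : EReal) - ((∑' i, (-c i).toENNReal : ℝ≥0∞) : EReal)

open Classical in
/-- The functional `G`: it is `∑ g(a_i)` if `ν = ∑ a_i δ_(x_i)` with distinct points `x_i`, and `+∞`
if `ν` is not atomic. The sum is taken over all points `x`, with `a = ν {x}`: as `g 0 = 0`, only
the (countably many) atoms contribute. -/
def concentrationCost {X : Type*} [MeasurableSpace X] (g : ℝ → EReal) (ν : Measure X) : EReal :=
  if IsAtomic ν then extSum fun x : X => g (ν.real {x}) else ⊤

/-- The Lebesgue measure on `Ω`, as a measure on the subtype. -/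
def lebesgueOn {n : ℕ} (Ω : Set (EuclideanSpace ℝ (Fin n))) : Measure Ω :=
  Measure.comap Subtype.val (volume : Measure (EuclideanSpace ℝ (Fin n)))

/-- The total cost `T_p(μ, ν) + F(μ) + G(ν)` on a set `Ω` of `ℝⁿ` with the Euclidean distance and the
Lebesgue measure. -/
def totalCost {n : ℕ} (Ω : Set (EuclideanSpace ℝ (Fin n))) (p : ℝ) (f : ℝ≥0∞ → ℝ≥0∞)
    (g : ℝ → EReal) (μ ν : ProbabilityMeasure Ω) : EReal :=
  (transportCost p (μ : Measure Ω) (ν : Measure Ω) : EReal)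
    + (densityCost (lebesgueOn Ω) f (μ : Measure Ω) : EReal) + concentrationCost g (ν : Measure Ω)

end UrbanPlanning

end

/-! Direct method. The probability measures on the compact space Ω × Ω form a weakly compact set,
and both the marginals and ∫ |x - y|^p dγ depend continuously on the plan γ. Minimising over plans
instead of pairs (μ, ν) therefore only requires F and G to be weakly lower semicontinuous.

For F, superlinearity makes each sublevel uniformly absolutely continuous, so weak convergence
inside it improves to convergence on every measurable set. By Jensen, F(μ) dominates every
discretized cost ∑ m(A_i) f(μ(A_i) / m(A_i)). These costs pass to the limit, and Fatou along ever
finer level sets of the limit density recovers F (`lowerSemicontinuous_densityCost`).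

For G, the infinite slope at 0 forces measures of bounded cost to put all but ε of their mass on
N(ε) points. This is a closed condition, so weak limits are atomic. Countable subadditivity bounds
the sum of g over the masses of disjoint balls by G, and shrinking balls around finitely many atoms
of the limit gives lower semicontinuity (`lowerSemicontinuous_atomicCost`). Since g may be negative,
the argument is run for g(t) + K t ≥ 0, which shifts G by the constant K on probability measures. -/

/-- A function is lower semicontinuous as soon as its finite sublevels pass to the limit along
arbitrary filters. -/
lemma lowerSemicontinuous_of_forall_filter {α : Type*} [TopologicalSpace α] {φ : α → ℝ≥0∞}
    (h : ∀ (C : ℝ≥0∞) (a : α) (l : Filter α), C ≠ ⊤ → l.NeBot → l ≤ 𝓝 a →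
      (∀ᶠ b in l, φ b ≤ C) → φ a ≤ C) : LowerSemicontinuous φ := by
  intro a C hC
  by_contra hcon
  have hfreq : ∃ᶠ b in 𝓝 a, φ b ≤ C := by
    refine (not_eventually.1 hcon).mono fun b hb => not_lt.1 hb
  have hne : (𝓝 a ⊓ 𝓟 {b | φ b ≤ C}).NeBot := frequently_mem_iff_neBot.1 hfreq
  exact absurd (h C a _ hC.ne_top hne inf_le_left
    (mem_inf_of_right (mem_principal_self _))) (not_le.2 hC)

/-- The sublevels of a lower semicontinuous function pass to the limit. -/
lemma LowerSemicontinuous.le_of_tendsto {α ι : Type*} [TopologicalSpace α] {φ : α → ℝ≥0∞}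
    (hφ : LowerSemicontinuous φ) {l : Filter ι} [l.NeBot] {x : ι → α} {a : α} {C : ℝ≥0∞}
    (hx : Tendsto x l (𝓝 a)) (h : ∀ᶠ i in l, φ (x i) ≤ C) : φ a ≤ C := by
  by_contra hcon
  obtain ⟨i, hi₁, hi₂⟩ := ((hx.eventually (hφ a C (not_le.1 hcon))).and h).exists
  exact absurd hi₁ (not_lt.2 hi₂)

/-! ### Affine minorants and Jensen's inequality -/

section Convex

variable {f : ℝ≥0∞ → ℝ≥0∞}

/-- A convex lower semicontinuous extended nonnegative function vanishing at zero is approximated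
from below by affine functions at each finite point. -/
lemma exists_affine_minorant (hf_convex : ConvexOn ℝ≥0 Set.univ f) (hf_lsc : LowerSemicontinuous f)
    (hf_zero : f 0 = 0) {t c : ℝ≥0} (hc : (c : ℝ≥0∞) < f t) :
    ∃ a b : ℝ, (c : ℝ) < a * t + b ∧ ∀ s : ℝ≥0, ENNReal.ofReal (a * s + b) ≤ f s := by
  -- The epigraph over finite arguments, moved into the real plane so that Hahn–Banach separates (t,
  -- c) from it.
  let E : Set (ℝ × ℝ) :=
    {z | (0 ≤ z.1 ∧ 0 ≤ z.2) ∧ f (ENNReal.ofReal z.1) ≤ ENNReal.ofReal z.2}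
  have hE_closed : IsClosed E := by
    refine ((isClosed_le continuous_const continuous_fst).inter
      (isClosed_le continuous_const continuous_snd)).inter ?_
    exact (lowerSemicontinuous_iff_isClosed_epigraph.1 hf_lsc).preimage
      (f := fun z : ℝ × ℝ => (ENNReal.ofReal z.1, ENNReal.ofReal z.2))
      ((ENNReal.continuous_ofReal.comp continuous_fst).prodMk
        (ENNReal.continuous_ofReal.comp continuous_snd))
  have hE_convex : Convex ℝ E := by
    rintro ⟨z₁, z₂⟩ ⟨⟨hz₁, hz₂⟩, hz⟩ ⟨w₁, w₂⟩ ⟨⟨hw₁, hw₂⟩, hw⟩ a b ha hb hab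
    simp only at hz₁ hz₂ hz hw₁ hw₂ hw
    refine ⟨⟨?_, ?_⟩, ?_⟩
    · simp only [Prod.fst_add, Prod.smul_fst, smul_eq_mul]; positivity
    · simp only [Prod.snd_add, Prod.smul_snd, smul_eq_mul]; positivity
    · simp only [Prod.fst_add, Prod.smul_fst, smul_eq_mul, Prod.snd_add, Prod.smul_snd]
      lift a to ℝ≥0 using ha
      lift b to ℝ≥0 using hb
      have hab' : a + b = 1 := by exact_mod_cast hab
      have key := hf_convex.2 (mem_univ (ENNReal.ofReal z₁)) (mem_univ (ENNReal.ofReal w₁))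
        (zero_le (a := a)) (zero_le (a := b)) hab'
      simp only [ENNReal.smul_def, smul_eq_mul] at key
      rw [ENNReal.ofReal_add (by positivity) (by positivity),
        ENNReal.ofReal_add (by positivity) (by positivity), ENNReal.ofReal_mul (by positivity),
        ENNReal.ofReal_mul (by positivity), ENNReal.ofReal_mul (by positivity),
        ENNReal.ofReal_mul (by positivity), ENNReal.ofReal_coe_nnreal, ENNReal.ofReal_coe_nnreal]
      exact key.trans (by gcongr)
  have hmem : ((t : ℝ), (c : ℝ)) ∉ E := by
    rintro ⟨-, h⟩
    simp only [ENNReal.ofReal_coe_nnreal] at h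
    exact absurd hc (not_lt.2 h)
  obtain ⟨φ, σ, hφ, hφE⟩ := geometric_hahn_banach_point_closed hE_convex hE_closed hmem
  set α := φ (1, 0)
  set β := φ (0, 1)
  have hφ_apply : ∀ s r : ℝ, φ (s, r) = α * s + β * r := by
    intro s r
    have : ((s, r) : ℝ × ℝ) = s • (1, 0) + r • (0, 1) := by simp
    rw [this, map_add, map_smul, map_smul, smul_eq_mul, smul_eq_mul]
    ring
  rw [hφ_apply] at hφ
  have hE_le : ∀ s r : ℝ≥0, f s ≤ r → σ < α * s + β * r := by
    intro s r h
    rw [← hφ_apply]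
    exact hφE _ ⟨⟨s.2, r.2⟩, by simpa using h⟩
  have hβ : 0 ≤ β := by
    by_contra hneg
    push Not at hneg
    -- The half-line above the origin lies in `E` because f(0) = 0; a negative β would take φ below
    -- σ along it.
    obtain ⟨k, hk⟩ := exists_nat_gt (-σ / -β)
    have h := hE_le 0 k (by simp [hf_zero])
    rw [div_lt_iff₀ (by linarith)] at hk
    simp only [NNReal.coe_zero, mul_zero, zero_add, NNReal.coe_natCast] at h
    nlinarith
  have hσ : σ < 0 := by simpa using hE_le 0 0 (by simp [hf_zero])
  have of_finite : ∀ a b : ℝ, (∀ s r : ℝ≥0, f s = r → a * s + b ≤ r) →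
      ∀ s : ℝ≥0, ENNReal.ofReal (a * s + b) ≤ f s := by
    intro a b h s
    rcases eq_or_ne (f s) ⊤ with hs | hs
    · simp [hs]
    · lift f s to ℝ≥0 using hs with r hr
      exact (ENNReal.ofReal_le_ofReal (h s r hr.symm)).trans (by simp)
  rcases hβ.eq_or_lt with hβ0 | hβpos
  -- Vertical hyperplane: σ - α s is positive at t and negative wherever f is finite, so a large
  -- multiple exceeds c at t and is still a minorant.
  · obtain ⟨k, hk⟩ := exists_nat_gt ((c : ℝ) / (σ - α * t))
    rw [← hβ0] at hφ
    rw [div_lt_iff₀ (by linarith)] at hk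
    refine ⟨-(k * α), k * σ, by linarith, of_finite _ _ fun s r hsr => ?_⟩
    have h := hE_le s r hsr.le
    rw [← hβ0] at h
    have : (k : ℝ) * (σ - α * s) ≤ 0 :=
      mul_nonpos_of_nonneg_of_nonpos (by positivity) (by linarith)
    have := r.2
    have : (0 : ℝ) ≤ r := r.2
    linarith
  · refine ⟨-(α / β), σ / β, ?_, of_finite _ _ fun s r hsr => ?_⟩
    · have : -(α / β) * t + σ / β = (σ - α * t) / β := by ring
      rw [this, lt_div_iff₀ hβpos]
      linarith
    · have : -(α / β) * s + σ / β = (σ - α * s) / β := by ring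
      rw [this, div_le_iff₀ hβpos]
      linarith [hE_le s r hsr.le]

/-- **Jensen's inequality** for extended nonnegative convex functions. -/
lemma measure_univ_mul_le_lintegral_comp {X : Type*} [MeasurableSpace X]
    (hf_convex : ConvexOn ℝ≥0 Set.univ f) (hf_lsc : LowerSemicontinuous f)
    (hf_zero : f 0 = 0) (m : Measure X) [IsFiniteMeasure m] {u : X → ℝ≥0∞} (hu : Measurable u)
    (hu_int : ∫⁻ x, u x ∂m ≠ ⊤) :
    m univ * f ((∫⁻ x, u x ∂m) / m univ) ≤ ∫⁻ x, f (u x) ∂m := by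
  rcases eq_or_ne (m univ) 0 with hm | hm
  · simp [hm]
  have hmt : m univ ≠ ⊤ := measure_ne_top _ _
  have ht : (∫⁻ x, u x ∂m) / m univ ≠ ⊤ := ENNReal.div_ne_top hu_int hm
  obtain ⟨t, ht'⟩ : ∃ t : ℝ≥0, (t : ℝ≥0∞) = (∫⁻ x, u x ∂m) / m univ :=
    ⟨_, ENNReal.coe_toNNReal ht⟩
  rw [← ht', mul_comm, ← ENNReal.le_div_iff_mul_le (Or.inl hm) (Or.inl hmt)]
  refine ENNReal.le_of_forall_nnreal_lt fun c hc => ?_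
  rw [ENNReal.le_div_iff_mul_le (Or.inl hm) (Or.inl hmt)]
  obtain ⟨a, b, hab, hle⟩ := exists_affine_minorant hf_convex hf_lsc hf_zero hc
  have hu_fin : ∀ᵐ x ∂m, u x < ⊤ := ae_lt_top hu hu_int
  have hint : Integrable (fun x => a * (u x).toReal + b) m :=
    ((integrable_toReal_of_lintegral_ne_top hu.aemeasurable hu_int).const_mul a).add
      (integrable_const b)
  have hval : ∫ x, (a * (u x).toReal + b) ∂m = (a * t + b) * m.real univ := by
    have hmr : m.real univ ≠ 0 := by
      rw [Measure.real, ENNReal.toReal_ne_zero]; exact ⟨hm, hmt⟩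
    have htr : (t : ℝ) = (∫⁻ x, u x ∂m).toReal / m.real univ := by
      rw [← ENNReal.coe_toReal, ht', ENNReal.toReal_div]; rfl
    rw [integral_add ((integrable_toReal_of_lintegral_ne_top hu.aemeasurable hu_int).const_mul a)
      (integrable_const b), integral_const_mul, integral_toReal hu.aemeasurable hu_fin,
      integral_const, htr, smul_eq_mul]
    field_simp
  calc (c : ℝ≥0∞) * m univ = ENNReal.ofReal (c * m.real univ) := by
        rw [ENNReal.ofReal_mul c.coe_nonneg, ENNReal.ofReal_coe_nnreal, ofReal_measureReal]
    _ ≤ ENNReal.ofReal (∫ x, (a * (u x).toReal + b) ∂m) := by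
        rw [hval]
        gcongr
    _ ≤ ENNReal.ofReal (∫⁻ x, ENNReal.ofReal (a * (u x).toReal + b) ∂m).toReal := by
        rw [integral_eq_lintegral_pos_part_sub_lintegral_neg_part hint]
        exact ENNReal.ofReal_le_ofReal (sub_le_self _ ENNReal.toReal_nonneg)
    _ ≤ ∫⁻ x, ENNReal.ofReal (a * (u x).toReal + b) ∂m := ENNReal.ofReal_toReal_le
    _ ≤ ∫⁻ x, f (u x) ∂m := by
        refine lintegral_mono_ae ?_
        filter_upwards [hu_fin] with x hx
        have := hle (u x).toNNReal
        rwa [ENNReal.coe_toNNReal hx.ne] at this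

end Convex

/-! ### Uniform absolute continuity and setwise convergence -/

section Density

open UrbanPlanning

variable {X : Type*} [MeasurableSpace X] {m : Measure X} {f : ℝ≥0∞ → ℝ≥0∞}

/-- Two densities of a finite measure agree almost everywhere, so any one of them realises the
infimum in `densityCost`. -/
lemma exists_density_of_densityCost_le {μ : Measure X} [IsFiniteMeasure μ] {C : ℝ≥0∞} (hC : C ≠ ⊤)
    (h : densityCost m f μ ≤ C) :
    ∃ u : X → ℝ≥0∞, Measurable u ∧ μ = m.withDensity u ∧ ∫⁻ x, f (u x) ∂m ≤ C := by
  have hlt : densityCost m f μ < ⊤ := h.trans_lt hC.lt_top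
  simp only [densityCost, iInf_lt_iff] at hlt
  obtain ⟨u, ⟨hu, hμ⟩, -⟩ := hlt
  refine ⟨u, hu, hμ, le_trans ?_ h⟩
  refine le_iInf₂ fun v hv => ?_
  have hu_int : ∫⁻ x, u x ∂m ≠ ⊤ := by
    rw [← setLIntegral_univ, ← withDensity_apply _ MeasurableSet.univ, ← hμ]
    exact measure_ne_top _ _
  have huv : u =ᵐ[m] v :=
    (withDensity_eq_iff hu.aemeasurable hv.1.aemeasurable hu_int).1 (hμ.symm.trans hv.2)
  exact (lintegral_congr_ae (huv.mono fun x hx => by simp only [hx])).le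

/-- Sublevels of a superlinear density functional are uniformly absolutely continuous. -/
lemma exists_pos_forall_measure_le_of_densityCost_le
    (hf : Tendsto (fun t : ℝ≥0 => f t / t) atTop (𝓝 ⊤)) {C : ℝ≥0∞} (hC : C ≠ ⊤)
    {ε : ℝ≥0} (hε : 0 < ε) :
    ∃ δ : ℝ≥0, 0 < δ ∧ ∀ (μ : Measure X) [IsFiniteMeasure μ], densityCost m f μ ≤ C →
      ∀ A, MeasurableSet A → m A ≤ δ → μ A ≤ ε := by
  lift C to ℝ≥0 using hC
  -- This makes C / L at most ε / 2, and the δ chosen below makes T δ at most ε / 2. The added ones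
  -- keep L positive and the denominator of δ nonzero.
  set L : ℝ≥0 := 2 * (C + 1) / ε with hL
  have hLpos : 0 < L := by positivity
  obtain ⟨T, hT⟩ := eventually_atTop.1
    (hf.eventually (lt_mem_nhds (ENNReal.coe_lt_top (r := L))))
  refine ⟨ε / (2 * (T + 1)), by positivity, fun μ _ hμ A hA hmA => ?_⟩
  obtain ⟨u, hu, hμu, hfu⟩ := exists_density_of_densityCost_le ENNReal.coe_ne_top hμ
  -- The growth condition says nothing about f(∞), so infinite values of u have to be excluded.
  have hu_fin : ∀ᵐ x ∂m, u x < ⊤ := by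
    refine ae_lt_top hu ?_
    rw [← setLIntegral_univ, ← withDensity_apply _ MeasurableSet.univ, ← hμu]
    exact measure_ne_top _ _
  have hpt : ∀ᵐ x ∂m, u x ≤ T + (L : ℝ≥0∞)⁻¹ * f (u x) := by
    filter_upwards [hu_fin] with x hx
    lift u x to ℝ≥0 using hx.ne with t
    rcases le_total t T with h | h
    · exact le_add_right (by exact_mod_cast h)
    · refine le_add_left ?_
      rcases eq_or_ne t 0 with h0 | h0
      · simp [h0]
      have := (hT t h).le
      rw [ENNReal.le_div_iff_mul_le (Or.inl (by exact_mod_cast h0)) (Or.inl ENNReal.coe_ne_top)]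
        at this
      rw [← ENNReal.div_eq_inv_mul, ENNReal.le_div_iff_mul_le
        (Or.inl (by exact_mod_cast hLpos.ne')) (Or.inl ENNReal.coe_ne_top), mul_comm]
      exact this
  calc μ A = ∫⁻ x in A, u x ∂m := by rw [hμu, withDensity_apply _ hA]
    _ ≤ ∫⁻ x in A, (T + (L : ℝ≥0∞)⁻¹ * f (u x)) ∂m := lintegral_mono_ae (ae_restrict_of_ae hpt)
    _ = T * m A + (L : ℝ≥0∞)⁻¹ * ∫⁻ x in A, f (u x) ∂m := by
        rw [lintegral_add_left measurable_const, setLIntegral_const,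
          lintegral_const_mul' _ _ (by simpa using hLpos.ne')]
    _ ≤ T * ((ε / (2 * (T + 1)) : ℝ≥0) : ℝ≥0∞) + (L : ℝ≥0∞)⁻¹ * C := by
        gcongr
        exact (setLIntegral_le_lintegral _ _).trans hfu
    _ ≤ ε := by
        rw [← ENNReal.coe_inv hLpos.ne']
        norm_cast
        rw [← NNReal.coe_le_coe, hL]
        push_cast
        have hε' : (0 : ℝ) < ε := hε
        have hT0 : (0 : ℝ) ≤ T := T.2
        have hC0 : (0 : ℝ) ≤ C := C.2
        have h1 : (T : ℝ) * (ε / (2 * (T + 1))) ≤ ε / 2 := by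
          rw [mul_div_assoc', div_le_div_iff₀ (by positivity) (by positivity)]
          nlinarith
        have h2 : (2 * ((C : ℝ) + 1) / ε)⁻¹ * C ≤ ε / 2 := by
          rw [inv_div, div_mul_eq_mul_div, div_le_div_iff₀ (by positivity) (by positivity)]
          nlinarith
        linarith

variable [TopologicalSpace X] [TopologicalSpace.PseudoMetrizableSpace X] [BorelSpace X]
  [IsFiniteMeasure m]

/-- The uniform absolute continuity along a filter passes to the weak limit. -/
lemma measure_le_of_eventually_le {l : Filter (ProbabilityMeasure X)} [l.NeBot]
    {μ : ProbabilityMeasure X} (hl : l ≤ 𝓝 μ) {ε δ : ℝ≥0}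
    (h : ∀ᶠ μ' : ProbabilityMeasure X in l,
      ∀ A, MeasurableSet A → m A ≤ δ → (μ' : Measure X) A ≤ ε) {A : Set X} (hA : m A < δ) :
    (μ : Measure X) A ≤ ε := by
  obtain ⟨U, hAU, hU, hmU⟩ := A.exists_isOpen_lt_of_lt (δ : ℝ≥0∞) hA
  refine (measure_mono hAU).trans <|
    (ProbabilityMeasure.le_liminf_measure_open_of_tendsto (tendsto_id'.2 hl) hU).trans ?_
  exact liminf_le_of_frequently_le' (h.mono fun μ' h' => h' U hU.measurableSet hmU.le).frequently

/-- Weak convergence of uniformly absolutely continuous probability measures is setwise. -/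
lemma tendsto_measure_of_forall_eventually_le {l : Filter (ProbabilityMeasure X)} [l.NeBot]
    {μ : ProbabilityMeasure X} (hl : l ≤ 𝓝 μ)
    (h : ∀ ε : ℝ≥0, 0 < ε → ∃ δ : ℝ≥0, 0 < δ ∧ ∀ᶠ μ' : ProbabilityMeasure X in l,
      ∀ A, MeasurableSet A → m A ≤ δ → (μ' : Measure X) A ≤ ε) {A : Set X} (hA : MeasurableSet A) :
    Tendsto (fun μ' : ProbabilityMeasure X => (μ' : Measure X) A) l (𝓝 ((μ : Measure X) A)) := by
  -- Closed sets inside B give the limsup bound, the remainder B \ K being uniformly small;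
  -- complements then give the liminf bound.
  have key : ∀ B, MeasurableSet B →
      limsup (fun μ' : ProbabilityMeasure X => (μ' : Measure X) B) l ≤ (μ : Measure X) B := by
    intro B hB
    refine ENNReal.le_of_forall_pos_le_add fun ε hε _ => ?_
    obtain ⟨δ, hδ, hev⟩ := h (ε / 2) (by positivity)
    obtain ⟨K, hKB, hK, hmK⟩ := hB.exists_isClosed_sdiff_lt (measure_ne_top m B)
      (ENNReal.coe_ne_zero.2 hδ.ne')
    have hlim := ProbabilityMeasure.limsup_measure_closed_le_of_tendsto (tendsto_id'.2 hl) hK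
    have hlt : limsup (fun μ' : ProbabilityMeasure X => (μ' : Measure X) K) l
        < (μ : Measure X) K + (ε / 2 : ℝ≥0) :=
      hlim.trans_lt (ENNReal.lt_add_right (measure_ne_top _ _)
        (ENNReal.coe_ne_zero.2 (by positivity)))
    refine limsup_le_of_le (h := ?_)
    filter_upwards [eventually_lt_of_limsup_lt hlt, hev] with μ' h₁ h₂
    calc (μ' : Measure X) B ≤ (μ' : Measure X) K + (μ' : Measure X) (B \ K) := by
          rw [← measure_union disjoint_sdiff_right (hB.diff hK.measurableSet)]
          exact measure_mono (by simp)
      _ ≤ ((μ : Measure X) K + (ε / 2 : ℝ≥0)) + (ε / 2 : ℝ≥0) :=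
          add_le_add h₁.le (h₂ _ (hB.diff hK.measurableSet) hmK.le)
      _ = (μ : Measure X) K + ε := by rw [add_assoc, ← ENNReal.coe_add, add_halves]
      _ ≤ (μ : Measure X) B + ε := by gcongr
  exact tendsto_of_le_liminf_of_limsup_le
    (le_measure_liminf_of_limsup_measure_compl_le hA (key _ hA.compl)) (key A hA)

end Density

/-! ### Discretization and lower semicontinuity of F -/

section Density

open UrbanPlanning

variable {X : Type*} [MeasurableSpace X] {m : Measure X} {f : ℝ≥0∞ → ℝ≥0∞}

/-- For c = 0 the division is not continuous, but the product vanishes identically. -/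
lemma lowerSemicontinuous_mul_comp_div (hf_lsc : LowerSemicontinuous f) {c : ℝ≥0∞} (hc : c ≠ ⊤) :
    LowerSemicontinuous fun t : ℝ≥0∞ => c * f (t / c) := by
  rcases eq_or_ne c 0 with rfl | h0
  · simpa using lowerSemicontinuous_const
  · exact (ENNReal.continuous_const_mul hc).comp_lowerSemicontinuous
      (hf_lsc.comp (ENNReal.continuous_div_const c h0)) fun a b hab => mul_le_mul' le_rfl hab

/-- Jensen's inequality on each cell; as f ≥ 0, whatever lies outside the chosen cells can be
dropped. -/
lemma sum_measure_mul_le_densityCost [IsFiniteMeasure m] (hf_convex : ConvexOn ℝ≥0 Set.univ f)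
    (hf_lsc : LowerSemicontinuous f) (hf_zero : f 0 = 0) {μ : Measure X} [IsFiniteMeasure μ]
    {ι : Type*} {A : ι → Set X} (hA : ∀ i, MeasurableSet (A i)) (hdisj : Pairwise (Function.onFun Disjoint A))
    (s : Finset ι) : ∑ i ∈ s, m (A i) * f (μ (A i) / m (A i)) ≤ densityCost m f μ := by
  refine le_iInf₂ fun u hu => ?_
  calc ∑ i ∈ s, m (A i) * f (μ (A i) / m (A i)) ≤ ∑ i ∈ s, ∫⁻ x in A i, f (u x) ∂m := by
        refine Finset.sum_le_sum fun i _ => ?_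
        have hμ : μ (A i) = ∫⁻ x in A i, u x ∂m := by rw [hu.2, withDensity_apply _ (hA i)]
        have := measure_univ_mul_le_lintegral_comp hf_convex hf_lsc hf_zero (m.restrict (A i)) hu.1
          (by rw [← hμ]; exact measure_ne_top _ _)
        rwa [Measure.restrict_apply_univ, ← hμ] at this
    _ = ∫⁻ x in ⋃ i ∈ s, A i, f (u x) ∂m :=
        (lintegral_biUnion_finset (hdisj.set_pairwise _) (fun i _ => hA i) _).symm
    _ ≤ ∫⁻ x, f (u x) ∂m := setLIntegral_le_lintegral _ _

lemma div_measure_mem_of_forall_le [IsFiniteMeasure m] {U : X → ℝ≥0} (hU : Measurable U)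
    {A : Set X} (hA : MeasurableSet A) (hm : m A ≠ 0) {c r : ℝ≥0∞}
    (h₁ : ∀ y ∈ A, (U y : ℝ≥0∞) ≤ c + r) (h₂ : ∀ y ∈ A, c ≤ U y + r) :
    m.withDensity (fun x => U x) A / m A ≤ c + r ∧
      c ≤ m.withDensity (fun x => U x) A / m A + r := by
  have hmt : m A ≠ ⊤ := measure_ne_top _ _
  rw [withDensity_apply _ hA]
  constructor
  · rw [ENNReal.div_le_iff hm hmt, ← setLIntegral_const]
    exact setLIntegral_mono measurable_const h₁
  · have key : c * m A ≤ ∫⁻ x in A, U x ∂m + r * m A := by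
      rw [← setLIntegral_const, ← setLIntegral_const, ← lintegral_add_right _ measurable_const]
      exact setLIntegral_mono (hU.coe_nnreal_ennreal.add_const r) h₂
    calc c = c * m A / m A := (ENNReal.mul_div_cancel_right hm hmt).symm
      _ ≤ (∫⁻ x in A, U x ∂m + r * m A) / m A := ENNReal.div_le_div_right key _
      _ = (∫⁻ x in A, U x ∂m) / m A + r := by
        rw [ENNReal.add_div, ENNReal.mul_div_cancel_right hm hmt]

/-- If the discretized costs along all countable measurable partitions are at most `C`, then so is
the cost. -/
lemma lintegral_comp_le_of_forall_partition [IsFiniteMeasure m] (hf_lsc : LowerSemicontinuous f)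
    {U : X → ℝ≥0} (hU : Measurable U) {C : ℝ≥0∞}
    (h : ∀ q : X → ℕ, Measurable q →
      ∑' i, m (q ⁻¹' {i}) * f (m.withDensity (fun x => U x) (q ⁻¹' {i}) / m (q ⁻¹' {i})) ≤ C) :
    ∫⁻ x, f (U x) ∂m ≤ C := by
  -- On each fibre of `q j` the function U varies by at most 1 / (j + 1), so its cell means `w j`
  -- converge to it.
  let q : ℕ → X → ℕ := fun j x => ⌊(j + 1 : ℝ≥0) * U x⌋₊
  have hq : ∀ j, Measurable (q j) := fun j => Nat.measurable_floor.comp (hU.const_mul _)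
  let w : ℕ → ℕ → ℝ≥0∞ := fun j i =>
    m.withDensity (fun x => U x) (q j ⁻¹' {i}) / m (q j ⁻¹' {i})
  -- A mean over a null cell is meaningless, but the countably many null cells have null union.
  have hne : ∀ᵐ x ∂m, ∀ j, m (q j ⁻¹' {q j x}) ≠ 0 := by
    refine ae_all_iff.2 fun j => ?_
    have : {x | ¬ m (q j ⁻¹' {q j x}) ≠ 0} ⊆
        ⋃ i ∈ {i : ℕ | m (q j ⁻¹' {i}) = 0}, q j ⁻¹' {i} := by
      intro x hx
      simp only [mem_ofPred_eq, not_not] at hx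
      exact mem_biUnion (x := q j x) hx rfl
    refine measure_mono_null this ((measure_biUnion_null_iff (to_countable _)).2 fun i hi => hi)
  have hclose : ∀ j x y, q j x = q j y → (U x : ℝ≥0∞) ≤ U y + ((j + 1 : ℝ≥0)⁻¹ : ℝ≥0) := by
    intro j x y hxy
    have h₁ : (j + 1 : ℝ≥0) * U x < q j x + 1 := Nat.lt_floor_add_one _
    have h₂ : (q j y : ℝ≥0) ≤ (j + 1 : ℝ≥0) * U y := Nat.floor_le zero_le
    rw [hxy] at h₁
    norm_cast
    have h₃ : (j + 1 : ℝ≥0) * U x ≤ (j + 1 : ℝ≥0) * (U y + (j + 1 : ℝ≥0)⁻¹) := by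
      rw [mul_add, mul_inv_cancel₀ (by positivity)]
      exact h₁.le.trans (by gcongr)
    exact_mod_cast le_of_mul_le_mul_left h₃ (by positivity)
  have hlim : ∀ᵐ x ∂m, Tendsto (fun j => w j (q j x)) atTop (𝓝 (U x)) := by
    filter_upwards [hne] with x hx
    have hbound : ∀ j, w j (q j x) ≤ U x + ((j + 1 : ℝ≥0)⁻¹ : ℝ≥0) ∧
        U x ≤ w j (q j x) + ((j + 1 : ℝ≥0)⁻¹ : ℝ≥0) := by
      intro j
      exact div_measure_mem_of_forall_le hU (hq j (measurableSet_singleton _)) (hx j)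
        (fun y hy => hclose j y x hy) (fun y hy => hclose j x y hy.symm)
    have hinv : Tendsto (fun j : ℕ => (((j + 1 : ℝ≥0)⁻¹ : ℝ≥0) : ℝ≥0∞)) atTop (𝓝 0) := by
      rw [← ENNReal.coe_zero, ENNReal.tendsto_coe]
      have := (tendsto_add_atTop_iff_nat 1).2 (tendsto_inv_atTop_nhds_zero_nat (𝕜 := ℝ≥0))
      exact_mod_cast this
    rw [ENNReal.tendsto_nhds ENNReal.coe_ne_top]
    intro ε hε
    filter_upwards [hinv.eventually (gt_mem_nhds hε)] with j hj
    refine ⟨tsub_le_iff_right.2 ((hbound j).2.trans ?_), (hbound j).1.trans ?_⟩ <;> gcongr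
  -- Lower semicontinuity of f along the cell means, then Fatou. The integral of the step function
  -- f(w_j(q_j(x))) is the discretized cost.
  calc ∫⁻ x, f (U x) ∂m ≤ ∫⁻ x, liminf (fun j => f (w j (q j x))) atTop ∂m := by
        refine lintegral_mono_ae ?_
        filter_upwards [hlim] with x hx
        exact (hf_lsc.le_liminf _).trans (liminf_le_liminf_of_le hx)
    _ ≤ liminf (fun j => ∫⁻ x, f (w j (q j x)) ∂m) atTop :=
        lintegral_liminf_le fun j => hf_lsc.measurable.comp
          ((measurable_from_nat (f := w j)).comp (hq j))
    _ ≤ C := by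
        refine liminf_le_of_frequently_le' (Eventually.of_forall fun j => ?_).frequently
        rw [← lintegral_map (f := fun i => f (w j i)) measurable_from_nat (hq j),
          lintegral_countable']
        refine le_trans (ENNReal.tsum_le_tsum fun i => ?_) (h (q j) (hq j))
        rw [Measure.map_apply (hq j) (measurableSet_singleton i), mul_comm]

variable [TopologicalSpace X] [TopologicalSpace.PseudoMetrizableSpace X] [BorelSpace X]
  [IsFiniteMeasure m]

/-- The density functional is lower semicontinuous for the weak convergence. -/
lemma lowerSemicontinuous_densityCost (hf_convex : ConvexOn ℝ≥0 Set.univ f)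
    (hf_lsc : LowerSemicontinuous f) (hf_zero : f 0 = 0)
    (hf : Tendsto (fun t : ℝ≥0 => f t / t) atTop (𝓝 ⊤)) :
    LowerSemicontinuous fun μ : ProbabilityMeasure X => densityCost m f μ := by
  refine lowerSemicontinuous_of_forall_filter fun C μ l hC _ hl hev => ?_
  have hui : ∀ ε : ℝ≥0, 0 < ε → ∃ δ : ℝ≥0, 0 < δ ∧ ∀ᶠ μ' : ProbabilityMeasure X in l,
      ∀ A, MeasurableSet A → m A ≤ δ → (μ' : Measure X) A ≤ ε := by
    intro ε hε
    obtain ⟨δ, hδ, h⟩ := exists_pos_forall_measure_le_of_densityCost_le (m := m) hf hC hε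
    exact ⟨δ, hδ, hev.mono fun μ' hμ' => h μ' hμ'⟩
  have hac : (μ : Measure X) ≪ m := by
    intro A hA
    refine le_antisymm (ENNReal.le_of_forall_pos_le_add fun ε hε _ => ?_) zero_le
    obtain ⟨δ, hδ, h⟩ := hui ε hε
    rw [zero_add]
    exact measure_le_of_eventually_le hl h (by rw [hA]; exact_mod_cast hδ)
  let U : X → ℝ≥0 := fun x => ((μ : Measure X).rnDeriv m x).toNNReal
  have hU : Measurable U := ((μ : Measure X).measurable_rnDeriv m).ennreal_toNNReal
  have hμU : (μ : Measure X) = m.withDensity fun x => U x := by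
    conv_lhs => rw [← Measure.withDensity_rnDeriv_eq _ _ hac]
    refine withDensity_congr_ae ?_
    filter_upwards [(μ : Measure X).rnDeriv_lt_top m] with x hx
    exact (ENNReal.coe_toNNReal hx.ne).symm
  refine (iInf₂_le (fun x => (U x : ℝ≥0∞)) ⟨hU.coe_nnreal_ennreal, hμU⟩).trans ?_
  refine lintegral_comp_le_of_forall_partition hf_lsc hU fun q hq => ?_
  rw [← hμU, ENNReal.tsum_eq_iSup_sum]
  refine iSup_le fun s => ?_
  have hA : ∀ i, MeasurableSet (q ⁻¹' {i}) := fun i => hq (measurableSet_singleton i)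
  -- The cost of finitely many cells is lower semicontinuous in the cell masses, which converge by
  -- setwise convergence.
  have hφ : LowerSemicontinuous fun t : ℕ → ℝ≥0∞ =>
      ∑ i ∈ s, m (q ⁻¹' {i}) * f (t i / m (q ⁻¹' {i})) :=
    lowerSemicontinuous_sum fun i _ =>
      (lowerSemicontinuous_mul_comp_div hf_lsc (measure_ne_top _ _)).comp (continuous_apply i)
  refine hφ.le_of_tendsto (a := fun i => (μ : Measure X) (q ⁻¹' {i}))
    (tendsto_pi_nhds.2 fun i => tendsto_measure_of_forall_eventually_le hl hui (hA i)) ?_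
  filter_upwards [hev] with μ' hμ'
  refine (sum_measure_mul_le_densityCost hf_convex hf_lsc hf_zero hA ?_ s).trans hμ'
  intro i j hij
  exact Disjoint.preimage q (by simpa using hij)

end Density

/-! ### Atomic measures and subadditivity -/

section Atoms

open UrbanPlanning

variable {X : Type*} [MeasurableSpace X]

lemma UrbanPlanning.IsAtomic.exists_countable [MeasurableSingletonClass X] {ν : Measure X}
    (h : IsAtomic ν) : ∃ S : Set X, S.Countable ∧ ν Sᶜ = 0 := by
  obtain ⟨a, x, rfl⟩ := h
  refine ⟨range x, countable_range x, ?_⟩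
  have hm : MeasurableSet (range x)ᶜ := (countable_range x).measurableSet.compl
  rw [Measure.sum_apply _ hm]
  simp [Measure.dirac_apply' _ hm]

/-- A measure carried by a countable set is the sum of its atoms. -/
lemma tsum_indicator_measure_singleton [MeasurableSingletonClass X] {ν : Measure X} {S : Set X}
    (hS : S.Countable) (hν : ν Sᶜ = 0) (A : Set X) :
    ∑' x, A.indicator (fun x => ν {x}) x = ν A := by
  have h₁ : ν A = ν (A ∩ S) := (measure_inter_conull hν).symm
  have h₂ : ν (A ∩ S) = ∑' x : (A ∩ S : Set X), ν {(x : X)} := by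
    conv_lhs => rw [← biUnion_of_singleton (A ∩ S)]
    exact measure_biUnion (hS.mono inter_subset_right) (pairwiseDisjoint_fiber id _)
      fun x _ => measurableSet_singleton x
  rw [h₁, h₂, tsum_subtype (A ∩ S) fun x => ν {x}]
  refine tsum_congr fun x => ?_
  by_cases hxA : x ∈ A
  · by_cases hxS : x ∈ S
    · simp [hxA, hxS]
    · have : ν {x} = 0 := measure_mono_null (singleton_subset_iff.2 hxS) hν
      simp [indicator, this]
  · simp [hxA]

lemma isAtomic_of_countable [MeasurableSingletonClass X] [Nonempty X] {ν : Measure X} {S : Set X}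
    (hS : S.Countable) (hν : ν Sᶜ = 0) : IsAtomic ν := by
  have := hS.to_subtype
  obtain ⟨e, he⟩ := exists_injective_nat S
  let x₀ : X := Classical.arbitrary X
  -- Indices outside the range of `e` receive mass 0 at a dummy point.
  refine ⟨Function.extend e (fun s => ν {(s : X)}) 0,
    Function.extend e (fun s => (s : X)) fun _ => x₀, ?_⟩
  ext B hB
  rw [Measure.sum_apply _ hB, ← tsum_indicator_measure_singleton hS hν B]
  have h₁ : ∀ i, (Function.extend e (fun s : S => ν {(s : X)}) 0 i •
      Measure.dirac (Function.extend e (fun s : S => (s : X)) (fun _ => x₀) i)) B =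
      Function.extend e (fun s : S => B.indicator (fun x => ν {x}) s) 0 i := by
    intro i
    by_cases hi : ∃ s, e s = i
    · obtain ⟨s, rfl⟩ := hi
      simp only [he.extend_apply, Measure.smul_apply, Measure.dirac_apply' _ hB, smul_eq_mul]
      by_cases hs : (s : X) ∈ B <;> simp [hs]
    · simp [Function.extend_apply' _ _ _ hi]
  rw [tsum_congr h₁, tsum_extend_zero he, tsum_subtype S (B.indicator fun x => ν {x})]
  refine tsum_congr fun x => ?_
  by_cases hxS : x ∈ S
  · simp [hxS]
  · have : ν {x} = 0 := measure_mono_null (singleton_subset_iff.2 hxS) hν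
    simp [hxS, this]

open Classical in
/-- The sum of `h` over the masses of the atoms of an atomic measure, and `∞` for the other
measures. -/
noncomputable def atomicCost (h : ℝ → ℝ≥0∞) (ν : Measure X) : ℝ≥0∞ :=
  if IsAtomic ν then ∑' x : X, h (ν.real {x}) else ⊤

variable {h : ℝ → ℝ≥0∞}

lemma map_sum_le_sum_of_subadd (h_zero : h 0 = 0)
    (h_subadd : ∀ s t : ℝ, 0 ≤ s → 0 ≤ t → s + t ≤ 1 → h (s + t) ≤ h s + h t) {ι : Type*}
    (s : Finset ι) {b : ι → ℝ} (hb : ∀ i, 0 ≤ b i) (hs : ∑ i ∈ s, b i ≤ 1) :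
    h (∑ i ∈ s, b i) ≤ ∑ i ∈ s, h (b i) := by
  classical
  induction s using Finset.induction_on with
  | empty => simp [h_zero]
  | insert i s hi ih =>
    rw [Finset.sum_insert hi] at hs ⊢
    rw [Finset.sum_insert hi]
    have hnn : 0 ≤ ∑ j ∈ s, b j := Finset.sum_nonneg fun j _ => hb j
    refine (h_subadd _ _ (hb i) hnn hs).trans ?_
    gcongr
    exact ih (by linarith [hb i])

/-- Lower semicontinuous subadditive functions are countably subadditive on the atoms. -/
lemma map_measureReal_le_tsum_indicator [MeasurableSingletonClass X] (h_lsc : LowerSemicontinuous h)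
    (h_zero : h 0 = 0)
    (h_subadd : ∀ s t : ℝ, 0 ≤ s → 0 ≤ t → s + t ≤ 1 → h (s + t) ≤ h s + h t)
    {ν : Measure X} [IsProbabilityMeasure ν] (hν : IsAtomic ν) (A : Set X) :
    h (ν.real A) ≤ ∑' x, A.indicator (fun x => h (ν.real {x})) x := by
  obtain ⟨S, hS, hνS⟩ := hν.exists_countable
  have hsum := tsum_indicator_measure_singleton hS hνS A
  have hHas : HasSum (fun x => A.indicator (fun x => ν.real {x}) x) (ν.real A) := by
    have hne : ∑' x, A.indicator (fun x => ν {x}) x ≠ ⊤ := by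
      rw [hsum]; exact measure_ne_top _ _
    have := ENNReal.hasSum_toReal hne
    rw [← ENNReal.tsum_toReal_eq (fun x => ENNReal.ne_top_of_tsum_ne_top hne x), hsum] at this
    convert this using 2 with x
    swap; · rfl
    by_cases hx : x ∈ A <;> simp [hx, Measure.real]
  have hnn : ∀ x, 0 ≤ A.indicator (fun x => ν.real {x}) x :=
    fun x => indicator_nonneg (fun _ _ => measureReal_nonneg) x
  -- Finite partial sums satisfy the bound by subadditivity; they tend to the mass of A, and lower
  -- semicontinuity passes to the limit.
  refine h_lsc.le_of_tendsto hHas (Eventually.of_forall fun s => ?_)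
  refine (map_sum_le_sum_of_subadd h_zero h_subadd s hnn
    ((sum_le_hasSum s (fun x _ => hnn x) hHas).trans measureReal_le_one)).trans ?_
  refine le_trans (le_of_eq (Finset.sum_congr rfl fun x _ => ?_)) (ENNReal.sum_le_tsum s)
  by_cases hx : x ∈ A <;> simp [hx, h_zero]

/-- Each atom lies in at most one of the sets, and h ≥ 0 discards the others. Passing from atoms to
sets is what allows weak limits: masses of suitable balls converge, masses of points need not. -/
lemma sum_map_measureReal_le_atomicCost [MeasurableSingletonClass X]
    (h_lsc : LowerSemicontinuous h) (h_zero : h 0 = 0)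
    (h_subadd : ∀ s t : ℝ, 0 ≤ s → 0 ≤ t → s + t ≤ 1 → h (s + t) ≤ h s + h t)
    (ν : Measure X) [IsProbabilityMeasure ν] {ι : Type*} (s : Finset ι) {A : ι → Set X}
    (hA : (s : Set ι).PairwiseDisjoint A) :
    ∑ i ∈ s, h (ν.real (A i)) ≤ atomicCost h ν := by
  by_cases hν : IsAtomic ν
  · rw [atomicCost, if_pos hν]
    calc ∑ i ∈ s, h (ν.real (A i))
        ≤ ∑ i ∈ s, ∑' x, (A i).indicator (fun x => h (ν.real {x})) x :=
          Finset.sum_le_sum fun i _ =>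
            map_measureReal_le_tsum_indicator h_lsc h_zero h_subadd hν (A i)
      _ = ∑' x, ∑ i ∈ s, (A i).indicator (fun x => h (ν.real {x})) x :=
          (Summable.tsum_finsetSum fun _ _ => ENNReal.summable).symm
      _ ≤ ∑' x, h (ν.real {x}) := ENNReal.tsum_le_tsum fun x => by
          rw [← Finset.indicator_biUnion_apply s A hA]
          exact indicator_le_self' (fun _ _ => zero_le) x
  · simp [atomicCost, hν]

/-- Measures of bounded cost are carried by a bounded number of points, up to a small mass. -/
lemma exists_finset_of_atomicCost_le [MeasurableSingletonClass X]
    (h_slope : ∀ L : ℝ≥0, ∃ δ : ℝ, 0 < δ ∧ ∀ t, 0 ≤ t → t < δ → L * ENNReal.ofReal t ≤ h t)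
    {C : ℝ≥0∞} (hC : C ≠ ⊤) {ε : ℝ≥0} (hε : 0 < ε) :
    ∃ N : ℕ, ∀ (ν : Measure X) [IsProbabilityMeasure ν], atomicCost h ν ≤ C →
      ∃ s : Finset X, s.card ≤ N ∧ ν (s : Set X)ᶜ ≤ ε := by
  lift C to ℝ≥0 using hC
  -- At most 1 / δ atoms have mass at least δ. The lighter ones have total mass at most C ε / (C +
  -- 1) ≤ ε.
  obtain ⟨δ, hδ, hslope⟩ := h_slope ((C + 1) / ε)
  have hLpos : 0 < (C + 1) / ε := by positivity
  refine ⟨⌈δ⁻¹⌉₊, fun ν _ hνC => ?_⟩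
  have hν : IsAtomic ν := by
    by_contra hν
    simp [atomicCost, hν] at hνC
  rw [atomicCost, if_pos hν] at hνC
  obtain ⟨S, hS, hνS⟩ := hν.exists_countable
  have hcard : ∀ s : Finset X, (s : Set X) ⊆ {x | δ ≤ ν.real {x}} → s.card ≤ ⌈δ⁻¹⌉₊ := by
    intro s hs
    have h₁ : ∑ x ∈ s, ν.real {x} ≤ 1 := by
      rw [← measureReal_biUnion_finset (f := fun x => ({x} : Set X)) (pairwiseDisjoint_fiber id _)
        (fun x _ => measurableSet_singleton x)]
      exact measureReal_le_one
    have h₂ : s.card * δ ≤ 1 := by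
      rw [← nsmul_eq_mul]
      exact (Finset.card_nsmul_le_sum s _ _ fun x hx => hs hx).trans h₁
    have h₃ : (s.card : ℝ) ≤ δ⁻¹ := by rwa [← one_div, le_div_iff₀ hδ]
    exact_mod_cast h₃.trans (Nat.le_ceil _)
  have hfin : {x | δ ≤ ν.real {x}}.Finite := by
    by_contra hinf
    obtain ⟨t, ht, htc⟩ := Set.Infinite.exists_subset_card_eq hinf (⌈δ⁻¹⌉₊ + 1)
    have := hcard t ht
    omega
  refine ⟨hfin.toFinset, hcard _ (by simp), ?_⟩
  rw [hfin.coe_toFinset, ← tsum_indicator_measure_singleton hS hνS]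
  have hle : ∀ x, {x | δ ≤ ν.real {x}}ᶜ.indicator (fun x => ν {x}) x ≤
      (((C + 1) / ε : ℝ≥0) : ℝ≥0∞)⁻¹ * h (ν.real {x}) := by
    intro x
    by_cases hx : δ ≤ ν.real {x}
    · simp [hx]
    · have := hslope _ measureReal_nonneg (not_le.1 hx)
      rw [ofReal_measureReal] at this
      rw [indicator_of_mem (by simpa using hx), ← ENNReal.div_eq_inv_mul,
        ENNReal.le_div_iff_mul_le (Or.inl (by exact_mod_cast hLpos.ne'))
          (Or.inl ENNReal.coe_ne_top), mul_comm]
      exact this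
  calc _ ≤ ∑' x, (((C + 1) / ε : ℝ≥0) : ℝ≥0∞)⁻¹ * h (ν.real {x}) := ENNReal.tsum_le_tsum hle
    _ ≤ (((C + 1) / ε : ℝ≥0) : ℝ≥0∞)⁻¹ * C := by
        rw [ENNReal.tsum_mul_left]
        gcongr
    _ ≤ ε := by
        rw [← ENNReal.coe_inv hLpos.ne']
        norm_cast
        rw [inv_div, div_mul_eq_mul_div, div_le_iff₀ (by positivity)]
        gcongr
        simp

end Atoms

/-! ### Weak limits of atomic measures -/

section AtomsLimit

open UrbanPlanning

variable {X : Type*} [MeasurableSpace X] [MetricSpace X] [BorelSpace X]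

/-- Being carried by at most `N` points up to a mass `ε` is a weakly closed condition. -/
lemma isClosed_setOf_exists_range_measure_ge [CompactSpace X] (N : ℕ) (ε : ℝ≥0∞) :
    IsClosed {ν : ProbabilityMeasure X |
      ∃ y : Fin N → X, 1 ≤ (ν : Measure X) (range y) + ε} := by
  -- The points become part of the data: `Z` is closed, and projecting away the compact factor of
  -- tuples keeps it closed.
  let Z : Set ((Fin N → X) × ProbabilityMeasure X) :=
    {z | 1 ≤ (z.2 : Measure X) (range z.1) + ε}
  have hZ : IsClosed Z := by
    refine isClosed_iff_forall_filter.2 ?_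
    rintro ⟨y, ν⟩ F hF hFZ hFlim
    have hy : Tendsto Prod.fst F (𝓝 y) := continuous_fst.continuousAt.mono_left hFlim
    have hν : Tendsto Prod.snd F (𝓝 ν) := continuous_snd.continuousAt.mono_left hFlim
    -- A closed thickening absorbs the motion of the points; letting r tend to 0 recovers the
    -- finite, hence closed, range.
    have hpos : ∀ r : ℝ, 0 < r → 1 ≤ (ν : Measure X) (Metric.cthickening r (range y)) + ε := by
      intro r hr
      have hsub : ∀ᶠ z in F, range z.1 ⊆ Metric.cthickening r (range y) := by
        have : ∀ᶠ z in F, ∀ i, dist (z.1 i) (y i) < r := by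
          refine eventually_all.2 fun i => ?_
          exact (tendsto_pi_nhds.1 hy i).eventually (Metric.ball_mem_nhds _ hr)
        filter_upwards [this] with z hz
        rintro _ ⟨i, rfl⟩
        exact Metric.mem_cthickening_of_dist_le _ _ _ _ (mem_range_self i) (hz i).le
      rw [← tsub_le_iff_right]
      refine le_trans ?_ (ProbabilityMeasure.limsup_measure_closed_le_of_tendsto hν
        (Metric.isClosed_cthickening (δ := r) (E := range y)))
      refine le_limsup_of_frequently_le' (Eventually.frequently ?_)
      filter_upwards [hsub, le_principal_iff.1 hFZ] with z hz hzZ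
      exact (tsub_le_iff_right.2 hzZ).trans (measure_mono hz)
    have hlim : Tendsto (fun r => (ν : Measure X) (Metric.cthickening r (range y)) + ε) (𝓝[>] 0)
        (𝓝 ((ν : Measure X) (range y) + ε)) :=
      ((tendsto_measure_cthickening_of_isClosed ⟨1, one_pos, measure_ne_top _ _⟩
        (finite_range y).isClosed).mono_left nhdsWithin_le_nhds).add_const ε
    exact ge_of_tendsto hlim (eventually_mem_nhdsWithin.mono hpos)
  convert isClosedMap_snd_of_compactSpace Z hZ using 1
  ext ν
  simp [Z]

variable {h : ℝ → ℝ≥0∞}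

/-- Weak limits of measures of bounded cost are atomic. -/
lemma isAtomic_of_eventually_atomicCost_le [CompactSpace X] [Nonempty X]
    (h_slope : ∀ L : ℝ≥0, ∃ δ : ℝ, 0 < δ ∧ ∀ t, 0 ≤ t → t < δ → L * ENNReal.ofReal t ≤ h t)
    {C : ℝ≥0∞} (hC : C ≠ ⊤) {l : Filter (ProbabilityMeasure X)} [l.NeBot]
    {ν : ProbabilityMeasure X} (hl : l ≤ 𝓝 ν)
    (hev : ∀ᶠ ν' : ProbabilityMeasure X in l, atomicCost h (ν' : Measure X) ≤ C) :
    IsAtomic (ν : Measure X) := by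
  have key : ∀ ε : ℝ≥0, 0 < ε →
      ∃ S : Set X, S.Countable ∧ 1 ≤ (ν : Measure X) S + ε := by
    intro ε hε
    obtain ⟨N, hN⟩ := exists_finset_of_atomicCost_le (X := X) h_slope hC hε
    have hmem : ν ∈ {ν : ProbabilityMeasure X |
        ∃ y : Fin N → X, 1 ≤ (ν : Measure X) (range y) + ε} := by
      refine (isClosed_setOf_exists_range_measure_ge N (ε : ℝ≥0∞)).mem_of_tendsto
        (tendsto_id'.2 hl) ?_
      filter_upwards [hev] with ν' hν'
      obtain ⟨s, hs, hsε⟩ := hN ν' hν'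
      -- When `s` has fewer than N points, the default value pads the enumeration; extra points only
      -- enlarge the range.
      let y : Fin N → X := fun i => s.toList.getD i (Classical.arbitrary X)
      refine ⟨y, ?_⟩
      have hsub : (s : Set X) ⊆ range y := by
        intro x hx
        obtain ⟨i, hi, hix⟩ := List.getElem_of_mem (Finset.mem_toList.2 (Finset.mem_coe.1 hx))
        have hiN : i < N := by
          rw [Finset.length_toList] at hi
          omega
        refine ⟨⟨i, hiN⟩, ?_⟩
        simp [y, List.getD, List.getElem?_eq_getElem hi, hix]
      calc (1 : ℝ≥0∞) = (ν' : Measure X) univ := measure_univ.symm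
        _ = (ν' : Measure X) (s : Set X) + (ν' : Measure X) (s : Set X)ᶜ :=
            (measure_add_measure_compl s.finite_toSet.measurableSet).symm
        _ ≤ (ν' : Measure X) (range y) + ε := by gcongr
    obtain ⟨y, hy⟩ := hmem
    exact ⟨range y, countable_range y, hy⟩
  choose! S hS hSε using fun n : ℕ => key (n + 1 : ℝ≥0)⁻¹ (by positivity)
  have hSc : (⋃ n, S n).Countable := countable_iUnion hS
  refine isAtomic_of_countable hSc ?_
  have hone : 1 ≤ (ν : Measure X) (⋃ n, S n) := by
    have hlim : Tendsto (fun n : ℕ => (ν : Measure X) (⋃ n, S n) + ((n + 1 : ℝ≥0)⁻¹ : ℝ≥0)) atTop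
        (𝓝 ((ν : Measure X) (⋃ n, S n) + 0)) := by
      refine tendsto_const_nhds.add ?_
      have := (tendsto_add_atTop_iff_nat 1).2 (tendsto_inv_atTop_nhds_zero_nat (𝕜 := ℝ≥0))
      rw [← ENNReal.coe_zero, ENNReal.tendsto_coe]
      exact_mod_cast this
    rw [add_zero] at hlim
    exact ge_of_tendsto' hlim fun n => (hSε n).trans (by gcongr; exact subset_iUnion S n)
  rw [prob_compl_eq_zero_iff hSc.measurableSet]
  exact le_antisymm prob_le_one hone

/-- The atomic cost is lower semicontinuous for the weak convergence. -/
lemma lowerSemicontinuous_atomicCost [CompactSpace X] [Nonempty X]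
    (h_lsc : LowerSemicontinuous h) (h_zero : h 0 = 0)
    (h_subadd : ∀ s t : ℝ, 0 ≤ s → 0 ≤ t → s + t ≤ 1 → h (s + t) ≤ h s + h t)
    (h_slope : ∀ L : ℝ≥0, ∃ δ : ℝ, 0 < δ ∧ ∀ t, 0 ≤ t → t < δ → L * ENNReal.ofReal t ≤ h t) :
    LowerSemicontinuous fun ν : ProbabilityMeasure X => atomicCost h (ν : Measure X) := by
  refine lowerSemicontinuous_of_forall_filter fun C ν l hC _ hl hev => ?_
  rw [atomicCost, if_pos (isAtomic_of_eventually_atomicCost_le h_slope hC hl hev),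
    ENNReal.tsum_eq_iSup_sum]
  refine iSup_le fun s => ?_
  have hΦ : LowerSemicontinuous fun t : X → ℝ => ∑ x ∈ s, h (t x) :=
    lowerSemicontinuous_sum fun x _ => h_lsc.comp (continuous_apply x)
  -- Radii tending to 0 whose balls have ν-null frontier, so that the ball masses converge along
  -- `l`.
  choose r hr hr' using fun x : X => exists_null_frontiers_thickening (ν : Measure X) {x}
  have hshrink : ∀ x, Tendsto (fun n => (ν : Measure X).real (Metric.thickening (r x n) {x})) atTop
      (𝓝 ((ν : Measure X).real {x})) := by
    intro x
    refine (ENNReal.tendsto_toReal (measure_ne_top _ _)).comp ?_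
    refine (tendsto_measure_thickening_of_isClosed ⟨1, one_pos, measure_ne_top _ _⟩
      isClosed_singleton).comp ?_
    exact tendsto_nhdsWithin_iff.2 ⟨hr x, Eventually.of_forall fun n => (hr' x n).1⟩
  have hdisj : ∀ᶠ n in atTop,
      (s : Set X).PairwiseDisjoint fun x => Metric.thickening (r x n) {x} := by
    have : ∀ᶠ n in atTop, ∀ x ∈ s, ∀ y ∈ s, x ≠ y → r x n + r y n < dist x y := by
      refine (Filter.eventually_all_finset s).2 fun x _ =>
        (Filter.eventually_all_finset s).2 fun y _ => ?_
      by_cases hxy : x = y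
      · simp [hxy]
      · have hlim := (hr x).add (hr y)
        rw [add_zero] at hlim
        exact (hlim.eventually (gt_mem_nhds (dist_pos.2 hxy))).mono fun n hn _ => hn
    filter_upwards [this] with n hn x hx y hy hxy
    simp only [Function.onFun, Metric.thickening_singleton]
    exact Metric.ball_disjoint_ball (hn x hx y hy hxy).le
  -- Lower semicontinuity is used twice: as the balls shrink to the atoms of ν, and, for a fixed
  -- disjoint family of balls, as ν' tends to ν.
  refine hΦ.le_of_tendsto (tendsto_pi_nhds.2 hshrink) ?_
  filter_upwards [hdisj] with n hn
  refine hΦ.le_of_tendsto (l := l)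
    (x := fun ν' x => (ν' : Measure X).real (Metric.thickening (r x n) {x}))
    (tendsto_pi_nhds.2 fun x => (ENNReal.tendsto_toReal (measure_ne_top _ _)).comp
      (ProbabilityMeasure.tendsto_measure_of_null_frontier_of_tendsto' (tendsto_id'.2 hl)
        (hr' x n).2)) ?_
  filter_upwards [hev] with ν' hν'
  exact (sum_map_measureReal_le_atomicCost h_lsc h_zero h_subadd _ s hn).trans hν'

end AtomsLimit

/-! ### Reduction to a nonnegative concentration density -/

section Penalization

open UrbanPlanning

variable {g : ℝ → EReal}

lemma exists_pos_forall_mul_le (hg_slope : Tendsto (fun t : ℝ => g t / (t : EReal)) (𝓝[>] 0) (𝓝 ⊤))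
    (L : ℝ) : ∃ δ : ℝ, 0 < δ ∧ ∀ t, 0 < t → t < δ → ((L * t : ℝ) : EReal) ≤ g t := by
  have h := hg_slope.eventually (lt_mem_nhds (EReal.coe_lt_top L))
  obtain ⟨δ, hδ, hsub⟩ := mem_nhdsGT_iff_exists_Ioo_subset.1 h
  refine ⟨δ, hδ, fun t ht htδ => ?_⟩
  have h₁ : (L : EReal) < g t / (t : EReal) := hsub ⟨ht, htδ⟩
  rw [EReal.coe_mul]
  exact (EReal.le_div_iff_mul_le (by exact_mod_cast ht) (EReal.coe_ne_top t)).1 h₁.le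

/-- Adding a linear term makes the concentration density nonnegative. -/
lemma exists_forall_nonneg_add_mul (hg_bot : ∀ t ∈ Set.Icc (0 : ℝ) 1, g t ≠ ⊥)
    (hg_lsc : LowerSemicontinuousOn g (Set.Icc (0 : ℝ) 1)) (hg_zero : g 0 = 0)
    (hg_slope : Tendsto (fun t : ℝ => g t / (t : EReal)) (𝓝[>] 0) (𝓝 ⊤)) :
    ∃ K : ℝ≥0, ∀ t ∈ Set.Icc (0 : ℝ) 1, 0 ≤ g t + ((K * t : ℝ) : EReal) := by
  obtain ⟨t₀, ht₀, hmin⟩ :=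
    hg_lsc.exists_isMinOn (nonempty_Icc.2 zero_le_one) isCompact_Icc
  obtain ⟨M, hM⟩ : ∃ M : ℝ≥0, ((-M : ℝ) : EReal) ≤ g t₀ := by
    induction hgt : g t₀ with
    | bot => exact absurd hgt (hg_bot t₀ ht₀)
    | top => exact ⟨0, le_top⟩
    | coe x =>
      refine ⟨(-x).toNNReal, ?_⟩
      rw [EReal.coe_le_coe_iff, Real.coe_toNNReal']
      linarith [le_max_left (-x) 0]
  obtain ⟨δ, hδ, hslope⟩ := exists_pos_forall_mul_le hg_slope 0
  lift δ to ℝ≥0 using hδ.le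
  have hδ' : 0 < δ := by exact_mod_cast hδ
  -- Below δ the slope condition gives g ≥ 0; from δ on, K t ≥ M offsets the lower bound -M of g.
  refine ⟨M / δ, fun t ht => ?_⟩
  have hnn : (0 : EReal) ≤ (((M / δ : ℝ≥0) * t : ℝ) : EReal) := by
    have := ht.1
    exact_mod_cast (by positivity : (0 : ℝ) ≤ (M / δ : ℝ≥0) * t)
  rcases ht.1.eq_or_lt with h0 | h0
  · simp [← h0, hg_zero]
  rcases lt_or_ge t δ with hlt | hge
  · exact add_nonneg (by simpa using hslope t h0 hlt) hnn
  · have h₁ : (0 : EReal) ≤ ((-M : ℝ) : EReal) + (((M / δ : ℝ≥0) * t : ℝ) : EReal) := by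
      rw [← EReal.coe_add]
      norm_cast
      push_cast
      have : (M : ℝ) = M / δ * δ := by field_simp
      have h2 : (M : ℝ) / δ * δ ≤ M / δ * t := by gcongr
      linarith
    exact h₁.trans (add_le_add_left (hM.trans (hmin ht)) _)

/-- The nonnegative concentration density obtained by adding `K t` to `g t` for `t ∈ [0, 1]`. -/
noncomputable def penalized (g : ℝ → EReal) (K : ℝ≥0) (t : ℝ) : ℝ≥0∞ :=
  (g (projIcc (0 : ℝ) 1 zero_le_one t) +
    ((K * (projIcc (0 : ℝ) 1 zero_le_one t : ℝ) : ℝ) : EReal)).toENNReal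

variable {K : ℝ≥0}

lemma penalized_of_mem {t : ℝ} (ht : t ∈ Icc (0 : ℝ) 1) :
    penalized g K t = (g t + ((K * t : ℝ) : EReal)).toENNReal := by
  simp [penalized, projIcc_of_mem zero_le_one ht]

/-- Clamping the argument extends lower semicontinuity from [0, 1] to the line; the added term is
finite, so addition is continuous there. -/
lemma lowerSemicontinuous_penalized (hg_lsc : LowerSemicontinuousOn g (Set.Icc (0 : ℝ) 1)) :
    LowerSemicontinuous (penalized g K) := by
  have hproj : Continuous fun t : ℝ => (projIcc (0 : ℝ) 1 zero_le_one t : ℝ) :=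
    continuous_subtype_val.comp continuous_projIcc
  have h₁ : LowerSemicontinuous fun t : ℝ => g (projIcc (0 : ℝ) 1 zero_le_one t) := by
    rw [← lowerSemicontinuousOn_univ_iff]
    exact hg_lsc.comp hproj.continuousOn fun t _ => (projIcc (0 : ℝ) 1 zero_le_one t).2
  have h₂ : Continuous fun t : ℝ =>
      ((K * (projIcc (0 : ℝ) 1 zero_le_one t : ℝ) : ℝ) : EReal) :=
    continuous_coe_real_ereal.comp (continuous_const.mul hproj)
  refine EReal.continuous_toENNReal.comp_lowerSemicontinuous
    (h₁.add' h₂.lowerSemicontinuous fun t => ?_) fun a b hab => EReal.toENNReal_le_toENNReal hab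
  exact EReal.continuousAt_add (Or.inr (EReal.coe_ne_bot _)) (Or.inr (EReal.coe_ne_top _))

lemma penalized_add_le
    (hK : ∀ t ∈ Set.Icc (0 : ℝ) 1, 0 ≤ g t + ((K * t : ℝ) : EReal))
    (hg_subadd : ∀ s t : ℝ, 0 ≤ s → 0 ≤ t → s + t ≤ 1 → g (s + t) ≤ g s + g t)
    {s t : ℝ} (hs : 0 ≤ s) (ht : 0 ≤ t) (hst : s + t ≤ 1) :
    penalized g K (s + t) ≤ penalized g K s + penalized g K t := by
  have hs' : s ∈ Icc (0 : ℝ) 1 := ⟨hs, by linarith⟩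
  have ht' : t ∈ Icc (0 : ℝ) 1 := ⟨ht, by linarith⟩
  rw [penalized_of_mem ⟨by positivity, hst⟩, penalized_of_mem hs', penalized_of_mem ht',
    ← EReal.toENNReal_add (hK s hs') (hK t ht')]
  refine EReal.toENNReal_le_toENNReal ?_
  rw [mul_add, EReal.coe_add, add_add_add_comm]
  exact add_le_add_left (hg_subadd s t hs ht hst) _

lemma exists_pos_forall_mul_le_penalized
    (hg_slope : Tendsto (fun t : ℝ => g t / (t : EReal)) (𝓝[>] 0) (𝓝 ⊤)) (L : ℝ≥0) :
    ∃ δ : ℝ, 0 < δ ∧ ∀ t, 0 ≤ t → t < δ → L * ENNReal.ofReal t ≤ penalized g K t := by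
  obtain ⟨δ, hδ, hslope⟩ := exists_pos_forall_mul_le hg_slope L
  refine ⟨min δ 1, by positivity, fun t ht htδ => ?_⟩
  rcases ht.eq_or_lt with rfl | h0
  · simp
  rw [penalized_of_mem ⟨ht, (htδ.trans_le (min_le_right _ _)).le⟩]
  have h₁ : ((L * t : ℝ) : EReal) ≤ g t + ((K * t : ℝ) : EReal) :=
    le_add_of_le_of_nonneg (hslope t h0 (htδ.trans_le (min_le_left _ _)))
      (by exact_mod_cast (by positivity : (0 : ℝ) ≤ K * t))
  refine le_trans (le_of_eq ?_) (EReal.toENNReal_le_toENNReal h₁)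
  rw [EReal.real_coe_toENNReal, ENNReal.ofReal_mul L.coe_nonneg, ENNReal.ofReal_coe_nnreal]

/-- The negative part of a is moved across the equality, so that the identity can be summed over
atoms without subtraction. -/
lemma toENNReal_add_ofReal {a : EReal} (ha : a ≠ ⊥) {b : ℝ} (hb : 0 ≤ b)
    (hab : 0 ≤ a + (b : EReal)) :
    a.toENNReal + ENNReal.ofReal b = (a + (b : EReal)).toENNReal + (-a).toENNReal := by
  induction a with
  | bot => exact absurd rfl ha
  | top => simp
  | coe x =>
    rw [← EReal.coe_add] at hab ⊢
    rw [← EReal.coe_neg]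
    simp only [EReal.real_coe_toENNReal]
    have hab' : 0 ≤ x + b := by exact_mod_cast hab
    rcases le_total 0 x with hx | hx
    · rw [ENNReal.ofReal_of_nonpos (neg_nonpos.2 hx), add_zero, ENNReal.ofReal_add hx hb]
    · rw [ENNReal.ofReal_of_nonpos hx, zero_add, ← ENNReal.ofReal_add hab' (neg_nonneg.2 hx)]
      congr 1
      ring

variable {X : Type*} [MeasurableSpace X] [MeasurableSingletonClass X]

/-- Up to the additive constant `K`, the concentration cost is the penalized atomic cost. -/
lemma concentrationCost_eq (hg_bot : ∀ t ∈ Set.Icc (0 : ℝ) 1, g t ≠ ⊥)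
    (hK : ∀ t ∈ Set.Icc (0 : ℝ) 1, 0 ≤ g t + ((K * t : ℝ) : EReal))
    (ν : Measure X) [IsProbabilityMeasure ν] :
    concentrationCost g ν = (atomicCost (penalized g K) ν : EReal) - ((K : ℝ) : EReal) := by
  by_cases hν : IsAtomic ν
  · rw [concentrationCost, atomicCost, if_pos hν, if_pos hν, extSum]
    have hmem : ∀ x, ν.real {x} ∈ Icc (0 : ℝ) 1 := fun x => ⟨measureReal_nonneg, measureReal_le_one⟩
    have hsum : ∑' x, ENNReal.ofReal (K * ν.real {x}) = K := by
      obtain ⟨S, hS, hνS⟩ := hν.exists_countable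
      have := tsum_indicator_measure_singleton hS hνS univ
      simp only [indicator_univ, measure_univ] at this
      have hval : ∀ x, ENNReal.ofReal (K * ν.real {x}) = K * ν {x} := fun x => by
        rw [ENNReal.ofReal_mul K.coe_nonneg, ofReal_measureReal, ENNReal.ofReal_coe_nnreal]
      rw [tsum_congr hval, ENNReal.tsum_mul_left, this, mul_one]
    have hpt : ∀ x, (g (ν.real {x})).toENNReal + ENNReal.ofReal (K * ν.real {x}) =
        penalized g K (ν.real {x}) + (-g (ν.real {x})).toENNReal := by
      intro x
      rw [penalized_of_mem (hmem x)]
      exact toENNReal_add_ofReal (hg_bot _ (hmem x)) (by positivity) (hK _ (hmem x))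
    have htot := tsum_congr (L := .unconditional X) hpt
    rw [ENNReal.tsum_add, ENNReal.tsum_add, hsum] at htot
    -- The negative part of g(a) is at most K a, so the negative parts have finite sum and the
    -- difference in `extSum` is meaningful.
    have hneg : ∑' x, (-g (ν.real {x})).toENNReal ≤ K := by
      rw [← hsum]
      refine ENNReal.tsum_le_tsum fun x => ?_
      rw [← EReal.real_coe_toENNReal]
      refine EReal.toENNReal_le_toENNReal ?_
      have h := hK _ (hmem x)
      induction hgx : g (ν.real {x}) with
      | bot => exact absurd hgx (hg_bot _ (hmem x))
      | top => simp
      | coe y =>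
        rw [hgx] at h
        norm_cast at h ⊢
        linarith
    generalize ∑' x, (-g (ν.real {x})).toENNReal = N at *
    generalize ∑' x, (g (ν.real {x})).toENNReal = P at *
    generalize ∑' x, penalized g K (ν.real {x}) = H at *
    lift N to ℝ≥0 using ne_top_of_le_ne_top ENNReal.coe_ne_top hneg
    induction P using ENNReal.recTopCoe with
    | top =>
      have hH : H = ⊤ := by simpa [eq_comm (a := (⊤ : ℝ≥0∞))] using htot
      subst hH
      simp
    | coe P =>
      have hH : H ≠ ⊤ := fun hH => by simp [hH] at htot
      lift H to ℝ≥0 using hH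
      have h1 : P + K = H + N := by exact_mod_cast htot
      have h2 : (P : ℝ) - N = H - K := by
        have : (P : ℝ) + K = H + N := by exact_mod_cast h1
        linarith
      simp only [EReal.coe_nnreal_eq_coe_real, ← EReal.coe_sub, h2]
  · simp [concentrationCost, atomicCost, hν]

end Penalization

/-! ### The direct method on transport plans -/

section Existence

open UrbanPlanning

variable {X : Type*} [MeasurableSpace X] [MetricSpace X] [BorelSpace X] [CompactSpace X]

/-- On a compact space the cost is a bounded continuous function, hence an admissible test function
for weak convergence. -/
lemma continuous_lintegral_edist_rpow {p : ℝ} (hp : 0 ≤ p) :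
    Continuous fun γ : ProbabilityMeasure (X × X) =>
      ∫⁻ z, edist z.1 z.2 ^ p ∂(γ : Measure (X × X)) := by
  let c : C(X × X, ℝ≥0) := ⟨fun z => nndist z.1 z.2 ^ p,
    (NNReal.continuous_rpow_const hp).comp (continuous_fst.nndist continuous_snd)⟩
  convert ProbabilityMeasure.continuous_lintegral_continuousMap c using 3 with γ
  funext z
  rw [edist_nndist, ← ENNReal.coe_rpow_of_nonneg _ hp]
  rfl

/-- Lower semicontinuous perturbations of the transport cost attain their minimum. -/
theorem exists_forall_transportCost_add_le [Nonempty X] {p : ℝ} (hp : 0 ≤ p)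
    {F H : ProbabilityMeasure X → ℝ≥0∞} (hF : LowerSemicontinuous F)
    (hH : LowerSemicontinuous H) :
    ∃ μ ν : ProbabilityMeasure X, ∀ μ' ν' : ProbabilityMeasure X,
      transportCost p (μ : Measure X) (ν : Measure X) + F μ + H ν ≤
        transportCost p (μ' : Measure X) (ν' : Measure X) + F μ' + H ν' := by
  let fst : ProbabilityMeasure (X × X) → ProbabilityMeasure X :=
    fun γ => γ.map measurable_fst.aemeasurable
  let snd : ProbabilityMeasure (X × X) → ProbabilityMeasure X :=
    fun γ => γ.map measurable_snd.aemeasurable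
  have hfst : Continuous fst := ProbabilityMeasure.continuous_map continuous_fst
  have hsnd : Continuous snd := ProbabilityMeasure.continuous_map continuous_snd
  let J : ProbabilityMeasure (X × X) → ℝ≥0∞ := fun γ =>
    ∫⁻ z, edist z.1 z.2 ^ p ∂(γ : Measure (X × X)) + F (fst γ) + H (snd γ)
  have hJ : LowerSemicontinuous J :=
    ((continuous_lintegral_edist_rpow hp).lowerSemicontinuous.add (hF.comp hfst)).add
      (hH.comp hsnd)
  obtain ⟨γ, -, hγ⟩ := (hJ.lowerSemicontinuousOn univ).exists_isMinOn
    ⟨⟨Measure.dirac (Classical.arbitrary (X × X)), inferInstance⟩, mem_univ _⟩ isCompact_univ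
  refine ⟨fst γ, snd γ, fun μ' ν' => ?_⟩
  calc transportCost p (fst γ : Measure X) (snd γ : Measure X) + F (fst γ) + H (snd γ) ≤ J γ := by
        simp only [J]
        gcongr
        exact iInf₂_le (γ : Measure (X × X)) ⟨rfl, rfl⟩
    _ ≤ transportCost p (μ' : Measure X) (ν' : Measure X) + F μ' + H ν' := by
        simp only [transportCost, add_assoc, ENNReal.iInf_add]
        refine le_iInf₂ fun γ' hγ' => ?_
        have hprob : IsProbabilityMeasure γ' := by
          refine ⟨?_⟩
          rw [← preimage_univ (f := Prod.fst), ← Measure.map_apply measurable_fst .univ, hγ'.1]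
          exact measure_univ
        have h : J γ ≤ J ⟨γ', hprob⟩ := hγ (mem_univ _)
        have h₁ : fst ⟨γ', hprob⟩ = μ' := Subtype.ext hγ'.1
        have h₂ : snd ⟨γ', hprob⟩ = ν' := Subtype.ext hγ'.2
        simp only [J, h₁, h₂] at h
        simp only [J, add_assoc] at h ⊢
        exact h

lemma isFiniteMeasure_lebesgueOn {n : ℕ} {Ω : Set (EuclideanSpace ℝ (Fin n))} (hΩ : IsCompact Ω) :
    IsFiniteMeasure (lebesgueOn Ω) := by
  refine ⟨?_⟩
  rw [lebesgueOn, comap_subtype_coe_apply hΩ.measurableSet]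
  simpa using hΩ.measure_lt_top

end Existence

theorem theorem2p1 {n : ℕ} (Ω : Set (EuclideanSpace ℝ (Fin n))) (hΩ : IsCompact Ω)
    (hΩne : Ω.Nonempty) (p : ℝ) (hp : 1 ≤ p)
    (f : ℝ≥0∞ → ℝ≥0∞) (hf_convex : ConvexOn ℝ≥0 Set.univ f) (hf_lsc : LowerSemicontinuous f)
    (hf_zero : f 0 = 0)
    (hf_superlinear : Tendsto (fun t : ℝ≥0 => f t / t) atTop (𝓝 ⊤))
    (g : ℝ → EReal) (hg_bot : ∀ t ∈ Set.Icc (0 : ℝ) 1, g t ≠ ⊥)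
    (hg_subadd : ∀ s t : ℝ, 0 ≤ s → 0 ≤ t → s + t ≤ 1 → g (s + t) ≤ g s + g t)
    (hg_lsc : LowerSemicontinuousOn g (Set.Icc (0 : ℝ) 1)) (hg_zero : g 0 = 0)
    (hg_slope : Tendsto (fun t : ℝ => g t / (t : EReal)) (𝓝[>] 0) (𝓝 ⊤)) :
    ∃ μ ν : ProbabilityMeasure Ω, ∀ μ' ν' : ProbabilityMeasure Ω,
      UrbanPlanning.totalCost Ω p f g μ ν ≤ UrbanPlanning.totalCost Ω p f g μ' ν' := by
  have : CompactSpace Ω := isCompact_iff_compactSpace.1 hΩ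
  have : Nonempty Ω := hΩne.to_subtype
  have : IsFiniteMeasure (UrbanPlanning.lebesgueOn Ω) := isFiniteMeasure_lebesgueOn hΩ
  obtain ⟨K, hK⟩ := exists_forall_nonneg_add_mul hg_bot hg_lsc hg_zero hg_slope
  obtain ⟨μ, ν, hmin⟩ := exists_forall_transportCost_add_le (X := Ω) (zero_le_one.trans hp)
    (lowerSemicontinuous_densityCost (m := UrbanPlanning.lebesgueOn Ω) hf_convex hf_lsc hf_zero
      hf_superlinear)
    (lowerSemicontinuous_atomicCost (lowerSemicontinuous_penalized (K := K) hg_lsc)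
      (by simp [penalized_of_mem, hg_zero])
      (fun _ _ => penalized_add_le hK hg_subadd)
      (exists_pos_forall_mul_le_penalized hg_slope))
  refine ⟨μ, ν, fun μ' ν' => ?_⟩
  -- Both totals are nonnegative penalized costs minus the same finite constant K, so minimality
  -- transfers.
  simp only [UrbanPlanning.totalCost, concentrationCost_eq hg_bot hK, sub_eq_add_neg, ← add_assoc,
    ← EReal.coe_ennreal_add]
  exact add_le_add_left (EReal.coe_ennreal_le_coe_ennreal_iff.2 (hmin μ' ν')) _
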